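/- All graphs are finite and loopless; parallel edges are allowed. Let $\ell\ge 2$ be an integer. For a graph $G$ let $e(G)$ be its number of edges, $\delta(G)$ its minimum degree, $d(v)$ the degree of a vertex $v$, $d(S)$ the number of edges with exactly one end in $S\subseteq V(G)$, $\mu_G(x,y)$ the number of edges joining $x$ and $y$, and $\mu(G)=\max_{x,y\in V(G)}\mu_G(x,y)$. A $\mathbb{Z}_{2\ell}$-boundary of $G$ is a map $\beta\colon V(G)\to\{0,1,\dots,2\ell-1\}$ with $\beta(v)\equiv d(v)\pmod 2$ for every vertex $v$ and $\sum_{v\in V(G)}\beta(v)\equiv 0\pmod{2\ell}$. The graph $G$ is strongly $\mathbb{Z}_\ell$-connected if for every $\mathbb{Z}_{2\ell}$-boundary $\beta$ of $G$ there is an orientation $D$ of $G$ with $d_D^+(v)-d_D^-(v)\equiv\beta(v)\pmod{2\ell}$ for every vertex $v$, where $d_D^+(v)$ and $d_D^-(v)$ are the numbers of arcs with tail $v$ and with head $v$. Theorem. Let $G_0$ be a graph with exactly $4$ vertices, and let $G$ be its simplified graph, that is, the graph on the same vertex set with $\mu_G(x,y)=\min\{\mu_{G_0}(x,y),\,\ell-1\}$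 for all $x\ne y$. Then $G_0$ is strongly $\mathbb{Z}_\ell$-connected if and only if $\delta(G)\ge \ell-1$, $e(G)\ge 3\ell-3$, and at least one of the following holds: 1. $\mu(G)=\ell-1$ or $e(G)\ge 3\ell-2$; 2. there is a set $S\subseteq V(G)$ with $|S|=2$ and $d(S)\ne 2\ell-2$; 3. there is a vertex $v\in V(G)$ with $d(v)\not\equiv \ell\pmod 2$. -/

import Mathlib

namespace Graph

variable {α β γ : Type*}

/-- `[X, Y]_G`: the edges with one end in `X` and the other end in `Y`. -/
def edgesBetween (G : Graph α β) (X Y : Set α) : Set β :=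
  {e | ∃ x ∈ X, ∃ y ∈ Y, G.IsLink e x y}

/-- `μ_G(x, y)`: the number of edges joining `x` and `y`. -/
noncomputable def pairMultiplicity (G : Graph α β) (x y : α) : ℕ :=
  (G.edgesBetween {x} {y}).ncard

/-- `μ(G)`: the largest multiplicity of a pair of vertices (a maximum, for finite graphs). -/
noncomputable def multiplicity (G : Graph α β) : ℕ :=
  sSup {m | ∃ x ∈ G.vertexSet, ∃ y ∈ G.vertexSet, G.pairMultiplicity x y = m}

/-- `e(G)`: the number of edges. -/
noncomputable def numEdges (G : Graph α β) : ℕ :=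
  G.edgeSet.ncard

/-- `d(v)`: the number of edges at `v`, a loop being counted twice. -/
noncomputable def vertexDegree (G : Graph α β) (v : α) : ℕ :=
  (G.incidenceSet v).ncard + (G.loopSet v).ncard

/-- `δ(G)`: the minimum degree. -/
noncomputable def minVertexDegree (G : Graph α β) : ℕ :=
  sInf (G.vertexDegree '' G.vertexSet)

/-- `d(S)`: the number of edges between `S` and its complement. -/
noncomputable def setDegree (G : Graph α β) (S : Set α) : ℕ :=
  (G.edgesBetween S (G.vertexSet \ S)).ncard

/-- An orientation of `G`: every edge is directed from one of its ends, its tail, to the other. -/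
structure Orientation (G : Graph α β) where
  tail : G.edgeSet → α
  head : G.edgeSet → α
  isLink : ∀ e : G.edgeSet, G.IsLink e (tail e) (head e)

/-- `d_D^+(v)`: the number of arcs with tail `v`. -/
noncomputable def Orientation.outDegree {G : Graph α β} (D : G.Orientation) (v : α) : ℕ :=
  {e | D.tail e = v}.ncard

/-- `d_D^-(v)`: the number of arcs with head `v`. -/
noncomputable def Orientation.inDegree {G : Graph α β} (D : G.Orientation) (v : α) : ℕ :=
  {e | D.head e = v}.ncard

/-- `b` is a parity-compliant `ℤ_{2ℓ}`-boundary of the (finite) graph `G`.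
Only the values of `b` at the vertices of `G` matter. -/
structure IsBoundary (G : Graph α β) (ℓ : ℕ) (b : α → ℕ) : Prop where
  lt : ∀ v ∈ G.vertexSet, b v < 2 * ℓ
  parity : ∀ v ∈ G.vertexSet, b v ≡ G.vertexDegree v [MOD 2]
  sum : ∑ᶠ v ∈ G.vertexSet, b v ≡ 0 [MOD 2 * ℓ]

/-- `D` is a `b`-orientation: out-degree minus in-degree is `b` modulo `2ℓ` at every vertex. -/
def Orientation.IsBoundaryOrientation {G : Graph α β} (D : G.Orientation) (ℓ : ℕ) (b : α → ℕ) :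
    Prop :=
  ∀ v ∈ G.vertexSet,
    (D.outDegree v : ℤ) - (D.inDegree v : ℤ) ≡ (b v : ℤ) [ZMOD 2 * (ℓ : ℤ)]

/-- The (finite) graph `G` is strongly `ℤ_ℓ`-connected. -/
def StronglyZConnected (G : Graph α β) (ℓ : ℕ) : Prop :=
  ∀ b : α → ℕ, G.IsBoundary ℓ b → ∃ D : G.Orientation, D.IsBoundaryOrientation ℓ b

/-- `G` is a simplified graph of `G₀` with respect to `ℓ`: a finite loopless graph on the same
vertices in which every multiplicity that is at least `ℓ - 1` has been replaced by `ℓ - 1`, all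
other multiplicities being unchanged. (The edges of `G` may be named at will.) -/
structure IsSimplifiedGraph (ℓ : ℕ) (G₀ : Graph α β) (G : Graph α γ) : Prop where
  vertexSet_eq : G.vertexSet = G₀.vertexSet
  edgeSet_finite : G.edgeSet.Finite
  loopless : G.Loopless
  pairMultiplicity_eq : ∀ x ∈ G₀.vertexSet, ∀ y ∈ G₀.vertexSet, x ≠ y →
    G.pairMultiplicity x y = min (G₀.pairMultiplicity x y) (ℓ - 1)

end Graph

/-!
By Hakimi's theorem, a function with the parity of the degrees is the net out-degree of an
orientation as soon as its sum over any set of vertices is at most the number of edges leaving the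
set in absolute value. Hence `G` is strongly `ℤ_ℓ`-connected when every boundary can be lifted to
an integral demand `r` that respects all cuts.

An orientation is an antisymmetric family of flows between pairs of vertices, and these flows only
matter modulo `2ℓ`. A pair joined by `ℓ - 1` edges carries flows of all residues of its parity,
so truncating multiplicities to `ℓ - 1` only shifts the demand by the change of parities.

On four vertices, lift the boundary to `-ℓ ≤ r < ℓ`, so that the values of `r` have sum `0`, `±2ℓ`
or `-4ℓ`. The degree and edge conditions leave enough room to cancel this sum, or to unload an
overloaded cut, by shifting a few values by `2ℓ`. The exception is `r = -ℓ` everywhere, possible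
only when all degrees are congruent to `ℓ` modulo `2`: two of the values then have to be raised
to `ℓ`, which requires a pair of vertices with at least `2ℓ` edges leaving it.
-/

namespace StrongZConnectivity

open Graph

variable {α β γ : Type*} {G : Graph α β}

section ArcCount

/-- The number of arcs of `D` leading from `S` to `T`. -/
noncomputable def arcCount (D : G.Orientation) (S T : Set α) : ℕ :=
  {e | D.tail e ∈ S ∧ D.head e ∈ T}.ncard

/-- The net out-degree `d_D^+(v) - d_D^-(v)`. -/
noncomputable def netOutDegree (D : G.Orientation) (v : α) : ℤ :=
  D.outDegree v - D.inDegree v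

theorem nonempty_orientation (G : Graph α β) : Nonempty G.Orientation := by
  choose tail head isLink using fun e : G.edgeSet => G.exists_isLink_of_mem_edgeSet e.2
  exact ⟨tail, head, isLink⟩

theorem ncard_edgesBetween (D : G.Orientation) (S T : Set α) :
    (G.edgesBetween S T).ncard =
      ({e | D.tail e ∈ S ∧ D.head e ∈ T} ∪ {e | D.tail e ∈ T ∧ D.head e ∈ S}).ncard := by
  rw [← Set.ncard_image_of_injective _ Subtype.val_injective]
  congr 1
  ext e
  constructor
  · rintro ⟨x, hx, y, hy, h⟩
    refine ⟨⟨e, h.edge_mem⟩, ?_, rfl⟩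
    obtain ⟨hx', hy'⟩ | ⟨hx', hy'⟩ := h.eq_and_eq_or_eq_and_eq (D.isLink ⟨e, h.edge_mem⟩)
    · exact .inl ⟨hx' ▸ hx, hy' ▸ hy⟩
    · exact .inr ⟨hy' ▸ hy, hx' ▸ hx⟩
  · rintro ⟨e, he | he, rfl⟩
    · exact ⟨_, he.1, _, he.2, D.isLink e⟩
    · exact ⟨_, he.2, _, he.1, (D.isLink e).symm⟩

theorem arcCount_self (D : G.Orientation) (S : Set α) :
    arcCount D S S = (G.edgesBetween S S).ncard := by
  rw [ncard_edgesBetween D, Set.union_self, arcCount]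

theorem edgesBetween_compl (S : Set α) :
    G.edgesBetween S Sᶜ = G.edgesBetween S (G.vertexSet \ S) := by
  ext e
  exact ⟨fun ⟨x, hx, y, hy, h⟩ => ⟨x, hx, y, ⟨h.right_mem, hy⟩, h⟩,
    fun ⟨x, hx, y, hy, h⟩ => ⟨x, hx, y, hy.2, h⟩⟩

theorem edgesBetween_vertexSet : G.edgesBetween G.vertexSet G.vertexSet = G.edgeSet := by
  ext e
  refine ⟨fun ⟨x, _, y, _, h⟩ => h.edge_mem, fun he => ?_⟩
  obtain ⟨x, y, h⟩ := G.exists_isLink_of_mem_edgeSet he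
  exact ⟨x, h.left_mem, y, h.right_mem, h⟩

theorem setDegree_vertexSet : G.setDegree G.vertexSet = 0 := by
  simp [setDegree, edgesBetween]

theorem pairMultiplicity_comm (x y : α) : G.pairMultiplicity x y = G.pairMultiplicity y x := by
  simp [pairMultiplicity, edgesBetween, G.isLink_comm]

theorem pairMultiplicity_self [G.Loopless] (x : α) : G.pairMultiplicity x x = 0 := by
  simp [pairMultiplicity, edgesBetween]

theorem outDegree_eq_arcCount (D : G.Orientation) (v : α) :
    D.outDegree v = arcCount D {v} Set.univ := by
  simp [Orientation.outDegree, arcCount]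

theorem inDegree_eq_arcCount (D : G.Orientation) (v : α) :
    D.inDegree v = arcCount D Set.univ {v} := by
  simp [Orientation.inDegree, arcCount]

variable [Finite G.edgeSet]

theorem arcCount_add_arcCount (D : G.Orientation) {S T : Set α} (hST : Disjoint S T) :
    arcCount D S T + arcCount D T S = (G.edgesBetween S T).ncard := by
  rw [ncard_edgesBetween D, Set.ncard_union_eq, arcCount, arcCount]
  exact Set.disjoint_left.2 fun e he he' => Set.disjoint_left.1 hST he.1 he'.1

theorem arcCount_union_right (D : G.Orientation) (S : Set α) {T U : Set α} (hTU : Disjoint T U) :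
    arcCount D S (T ∪ U) = arcCount D S T + arcCount D S U := by
  rw [arcCount, arcCount, arcCount, ← Set.ncard_union_eq]
  · congr 1
    ext e
    simp only [Set.mem_union, Set.mem_ofPred_eq, and_or_left]
  · exact Set.disjoint_left.2 fun e he he' => Set.disjoint_left.1 hTU he.2 he'.2

theorem arcCount_union_left (D : G.Orientation) {S T : Set α} (U : Set α) (hST : Disjoint S T) :
    arcCount D (S ∪ T) U = arcCount D S U + arcCount D T U := by
  rw [arcCount, arcCount, arcCount, ← Set.ncard_union_eq]
  · congr 1
    ext e
    simp only [Set.mem_union, Set.mem_ofPred_eq, or_and_right]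
  · exact Set.disjoint_left.2 fun e he he' => Set.disjoint_left.1 hST he.1 he'.1

theorem arcCount_coe_left (D : G.Orientation) (S : Finset α) (T : Set α) :
    arcCount D S T = ∑ x ∈ S, arcCount D {x} T := by
  classical
  induction S using Finset.induction_on with
  | empty => simp [arcCount]
  | insert x S hx ih =>
    rw [Finset.sum_insert hx, ← ih, Finset.coe_insert, Set.insert_eq, arcCount_union_left]
    exact Set.disjoint_singleton_left.2 hx

theorem arcCount_coe_right (D : G.Orientation) (S : Set α) (T : Finset α) :
    arcCount D S T = ∑ y ∈ T, arcCount D S {y} := by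
  classical
  induction T using Finset.induction_on with
  | empty => simp [arcCount]
  | insert y T hy ih =>
    rw [Finset.sum_insert hy, ← ih, Finset.coe_insert, Set.insert_eq, arcCount_union_right]
    exact Set.disjoint_singleton_left.2 hy

theorem sum_outDegree (D : G.Orientation) (S : Finset α) :
    ∑ v ∈ S, D.outDegree v = arcCount D S S + arcCount D S (↑S)ᶜ := by
  rw [← arcCount_union_right D _ disjoint_compl_right, Set.union_compl_self, arcCount_coe_left]
  exact Finset.sum_congr rfl fun v _ => outDegree_eq_arcCount D v

theorem sum_inDegree (D : G.Orientation) (S : Finset α) :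
    ∑ v ∈ S, D.inDegree v = arcCount D S S + arcCount D (↑S)ᶜ S := by
  rw [← arcCount_union_left D _ disjoint_compl_right, Set.union_compl_self, arcCount_coe_right]
  exact Finset.sum_congr rfl fun v _ => inDegree_eq_arcCount D v

theorem arcCount_compl_add_arcCount_compl (D : G.Orientation) (S : Set α) :
    arcCount D S Sᶜ + arcCount D Sᶜ S = G.setDegree S := by
  rw [arcCount_add_arcCount D disjoint_compl_right, edgesBetween_compl, setDegree]

theorem outDegree_add_inDegree (D : G.Orientation) (v : α) :
    D.outDegree v + D.inDegree v = G.vertexDegree v := by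
  have hinc : G.incidenceSet v = Subtype.val '' ({e | D.tail e = v} ∪ {e | D.head e = v}) := by
    ext e
    constructor
    · rintro ⟨w, h⟩
      refine ⟨⟨e, h.edge_mem⟩, ?_, rfl⟩
      obtain ⟨h, -⟩ | ⟨h, -⟩ := h.eq_and_eq_or_eq_and_eq (D.isLink ⟨e, h.edge_mem⟩)
      exacts [.inl h.symm, .inr h.symm]
    · rintro ⟨e, rfl | rfl, rfl⟩
      exacts [(D.isLink e).inc_left, (D.isLink e).symm.inc_left]
  have hloop : G.loopSet v = Subtype.val '' ({e | D.tail e = v} ∩ {e | D.head e = v}) := by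
    ext e
    constructor
    · intro h
      refine ⟨⟨e, h.edge_mem⟩, ?_, rfl⟩
      obtain ⟨h, h'⟩ | ⟨h, h'⟩ := h.eq_and_eq_or_eq_and_eq (D.isLink ⟨e, h.edge_mem⟩)
      exacts [⟨h.symm, h'.symm⟩, ⟨h'.symm, h.symm⟩]
    · rintro ⟨e, ⟨ht, hh⟩, rfl⟩
      subst ht
      exact hh ▸ D.isLink e
  rw [vertexDegree, hinc, hloop, Set.ncard_image_of_injective _ Subtype.val_injective,
    Set.ncard_image_of_injective _ Subtype.val_injective, Set.ncard_union_add_ncard_inter,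
    Orientation.outDegree, Orientation.inDegree]

theorem sum_netOutDegree (D : G.Orientation) (S : Finset α) :
    ∑ v ∈ S, netOutDegree D v = (arcCount D S (↑S)ᶜ : ℤ) - arcCount D (↑S)ᶜ S := by
  have hout := sum_outDegree D S
  have hin := sum_inDegree D S
  simp only [netOutDegree, Finset.sum_sub_distrib]
  zify at hout hin
  linarith

theorem sum_vertexDegree (S : Finset α) :
    ∑ v ∈ S, G.vertexDegree v = G.setDegree S + 2 * (G.edgesBetween S S).ncard := by
  obtain ⟨D⟩ := nonempty_orientation G
  simp only [← outDegree_add_inDegree D, Finset.sum_add_distrib, sum_outDegree, sum_inDegree,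
    ← arcCount_compl_add_arcCount_compl D, ← arcCount_self D]
  ring

theorem sum_vertexDegree_vertexSet {V : Finset α} (hV : G.vertexSet = V) :
    ∑ v ∈ V, G.vertexDegree v = 2 * G.numEdges := by
  rw [sum_vertexDegree, ← hV, setDegree_vertexSet, edgesBetween_vertexSet, numEdges, zero_add]

theorem setDegree_eq_sum [DecidableEq α] {V : Finset α} (hV : G.vertexSet = V) (S : Finset α) :
    G.setDegree S = ∑ x ∈ S, ∑ y ∈ V \ S, G.pairMultiplicity x y := by
  obtain ⟨D⟩ := nonempty_orientation G
  have hdisj : Disjoint (S : Set α) ↑(V \ S) := by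
    exact_mod_cast Finset.disjoint_sdiff
  rw [setDegree, hV, ← Finset.coe_sdiff, ← arcCount_add_arcCount D hdisj, arcCount_coe_left,
    arcCount_coe_right, ← Finset.sum_add_distrib]
  refine Finset.sum_congr rfl fun x hx => ?_
  rw [arcCount_coe_right, arcCount_coe_left, ← Finset.sum_add_distrib]
  refine Finset.sum_congr rfl fun y hy => arcCount_add_arcCount D (Set.disjoint_singleton.2 ?_)
  rintro rfl
  exact (Finset.mem_sdiff.1 hy).2 hx

theorem setDegree_singleton [G.Loopless] (v : α) : G.setDegree {v} = G.vertexDegree v := by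
  have h := sum_vertexDegree (G := G) {v}
  rw [Finset.sum_singleton, Finset.coe_singleton] at h
  rw [h, ← pairMultiplicity, pairMultiplicity_self, mul_zero, add_zero]

end ArcCount

section Realization

/-- `r` obeys the bounds that the cuts of `G` impose on the net out-degrees of its orientations.
Taking the cut of all vertices, these bounds include that the values of `r` have sum `0`. -/
def IsCutBounded (G : Graph α β) (r : α → ℤ) : Prop :=
  ∀ S : Finset α, (S : Set α) ⊆ G.vertexSet → |∑ v ∈ S, r v| ≤ G.setDegree S

theorem IsCutBounded.neg {r : α → ℤ} (hr : IsCutBounded G r) : IsCutBounded G (-r) := by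
  intro S hS
  simpa [abs_neg] using hr S hS

variable {V : Finset α}

theorem IsCutBounded.sum_eq_zero {r : α → ℤ} (hr : IsCutBounded G r) (hV : G.vertexSet = V) :
    ∑ v ∈ V, r v = 0 := by
  simpa [← hV, setDegree_vertexSet] using hr V hV.ge

variable [Finite G.edgeSet]

theorem setDegree_singleton_le (v : α) : G.setDegree {v} ≤ G.vertexDegree v := by
  simpa using (sum_vertexDegree (G := G) {v}).ge.trans' (Nat.le_add_right _ _)

theorem IsCutBounded.abs_le {r : α → ℤ} (hr : IsCutBounded G r) {v : α} (hv : v ∈ G.vertexSet) :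
    |r v| ≤ G.vertexDegree v := by
  have h := hr {v} (by simpa using hv)
  rw [Finset.sum_singleton, Finset.coe_singleton] at h
  exact h.trans (mod_cast setDegree_singleton_le v)

theorem exists_injective_slot (hV : G.vertexSet = V) {p : α → ℕ}
    (hp : ∀ S ⊆ V, (G.edgesBetween S S).ncard ≤ ∑ v ∈ S, p v) :
    ∃ f : G.edgeSet → (_ : α) × ℕ, f.Injective ∧
      ∀ e : G.edgeSet, G.Inc e (f e).1 ∧ (f e).2 < p (f e).1 := by
  classical
  let slots (e : G.edgeSet) : Finset ((_ : α) × ℕ) :=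
    (V.filter (G.Inc e)).sigma fun v => Finset.range (p v)
  suffices hall : ∀ A : Finset G.edgeSet, A.card ≤ (A.biUnion slots).card by
    obtain ⟨f, hf, hfs⟩ := (Finset.all_card_le_biUnion_card_iff_exists_injective slots).1 hall
    refine ⟨f, hf, fun e => ?_⟩
    have h := hfs e
    simp only [slots, Finset.mem_sigma, Finset.mem_filter, Finset.mem_range] at h
    exact ⟨h.1.2, h.2⟩
  intro A
  let S := V.filter fun v => ∃ e ∈ A, G.Inc e v
  have hslots : A.biUnion slots = S.sigma fun v => Finset.range (p v) := by
    ext ⟨v, i⟩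
    simp only [slots, S, Finset.mem_biUnion, Finset.mem_sigma, Finset.mem_filter]
    tauto
  have hA : (fun e : G.edgeSet => e.1) '' A ⊆ G.edgesBetween S S := by
    rintro _ ⟨e, he, rfl⟩
    obtain ⟨x, y, h⟩ := G.exists_isLink_of_mem_edgeSet e.2
    have hmem {v : α} (hv : G.Inc e v) : v ∈ S :=
      Finset.mem_filter.2 ⟨by simpa [hV] using hv.vertex_mem, e, he, hv⟩
    exact ⟨x, hmem h.inc_left, y, hmem h.inc_right, h⟩
  calc A.card
      = ((fun e : G.edgeSet => e.1) '' A).ncard := by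
        rw [Set.ncard_image_of_injective _ Subtype.val_injective, Set.ncard_coe_finset]
    _ ≤ (G.edgesBetween S S).ncard :=
        Set.ncard_le_ncard hA (G.edgeSet.toFinite.subset fun e ⟨_, _, _, _, h⟩ => h.edge_mem)
    _ ≤ ∑ v ∈ S, p v := hp S (Finset.filter_subset _ _)
    _ = (A.biUnion slots).card := by simp [hslots, Finset.card_sigma]

theorem sum_outDegree_vertexSet (hV : G.vertexSet = V) (D : G.Orientation) :
    ∑ v ∈ V, D.outDegree v = G.numEdges := by
  have h : arcCount D V (↑V)ᶜ = 0 := by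
    simp only [arcCount, ← hV]
    rw [Set.ncard_eq_zero]
    exact Set.eq_empty_of_forall_notMem fun e he => he.2 (D.isLink e).right_mem
  rw [sum_outDegree, h, arcCount_self, ← hV, edgesBetween_vertexSet, numEdges, add_zero]

/-- Hakimi's theorem. -/
theorem exists_orientation_outDegree_eq (hV : G.vertexSet = V) {p : α → ℕ}
    (hsum : ∑ v ∈ V, p v = G.numEdges)
    (hp : ∀ S ⊆ V, (G.edgesBetween S S).ncard ≤ ∑ v ∈ S, p v) :
    ∃ D : G.Orientation, ∀ v ∈ V, D.outDegree v = p v := by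
  obtain ⟨f, hf, hfp⟩ := exists_injective_slot hV hp
  choose head hhead using fun e : G.edgeSet => (hfp e).1
  let D : G.Orientation := ⟨fun e => (f e).1, head, hhead⟩
  have hle (v : α) : D.outDegree v ≤ p v := by
    have hmaps : ∀ e ∈ {e | D.tail e = v}, (f e).2 ∈ (Finset.range (p v) : Set ℕ) := by
      rintro e rfl
      simpa using (hfp e).2
    have hinj : Set.InjOn (fun e => (f e).2) {e | D.tail e = v} := fun e he e' he' h =>
      hf (Sigma.ext (he.trans he'.symm) (heq_of_eq h))
    simpa [Orientation.outDegree, Set.ncard_coe_finset] using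
      Set.ncard_le_ncard_of_injOn _ hmaps hinj
  refine ⟨D, (Finset.sum_eq_sum_iff_of_le fun v _ => hle v).1 ?_⟩
  rw [sum_outDegree_vertexSet hV, hsum]

theorem isCutBounded_netOutDegree (D : G.Orientation) : IsCutBounded G (netOutDegree D) := by
  intro S _
  rw [sum_netOutDegree, ← arcCount_compl_add_arcCount_compl D, abs_le]
  omega

theorem IsCutBounded.exists_netOutDegree_eq (hV : G.vertexSet = V) {r : α → ℤ}
    (hr : IsCutBounded G r) (hpar : ∀ v ∈ V, r v ≡ G.vertexDegree v [ZMOD 2]) :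
    ∃ D : G.Orientation, ∀ v ∈ V, netOutDegree D v = r v := by
  obtain ⟨p, hp⟩ : ∃ p : α → ℕ, ∀ v ∈ V, 2 * (p v : ℤ) = r v + G.vertexDegree v := by
    refine ⟨fun v => ((r v + G.vertexDegree v) / 2).toNat, fun v hv => ?_⟩
    have hbound := _root_.abs_le.1 (hr.abs_le (v := v) (by simpa [hV] using hv))
    have := (hpar v hv).dvd
    dsimp only
    omega
  have hsum (S : Finset α) (hS : S ⊆ V) : 2 * ∑ v ∈ S, (p v : ℤ) =
      ∑ v ∈ S, r v + (G.setDegree S + 2 * (G.edgesBetween S S).ncard) := by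
    rw [Finset.mul_sum, Finset.sum_congr rfl fun v hv => hp v (hS hv), Finset.sum_add_distrib]
    exact congrArg (∑ v ∈ S, r v + ·) (mod_cast sum_vertexDegree S)
  have htotal : ∑ v ∈ V, p v = G.numEdges := by
    have h := hsum V subset_rfl
    rw [hr.sum_eq_zero hV, ← hV, setDegree_vertexSet, edgesBetween_vertexSet] at h
    push_cast at h
    zify [numEdges]
    linarith
  have hle (S : Finset α) (hS : S ⊆ V) : (G.edgesBetween S S).ncard ≤ ∑ v ∈ S, p v := by
    have h := hsum S hS
    have := _root_.abs_le.1 (hr S (by simpa [hV] using hS))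
    zify
    linarith
  obtain ⟨D, hD⟩ := exists_orientation_outDegree_eq hV htotal hle
  refine ⟨D, fun v hv => ?_⟩
  have h := hp v hv
  rw [← outDegree_add_inDegree D, ← hD v hv] at h
  rw [netOutDegree]
  push_cast at h
  linarith

end Realization

section Boundary

/-- Up to multiples of `2ℓ`, the values of `q` are the net out-degrees allowed by the cuts of `G`.
Unlike in `Graph.IsBoundary`, representatives modulo `2ℓ` are not restricted to `[0, 2ℓ)`. -/
def IsRealizableMod (G : Graph α β) (ℓ : ℕ) (q : α → ℤ) : Prop :=
  ∃ r : α → ℤ, (∀ v ∈ G.vertexSet, r v ≡ q v [ZMOD 2 * ℓ]) ∧ IsCutBounded G r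

variable {ℓ : ℕ} {V : Finset α}

theorem IsRealizableMod.of_modEq {q q' : α → ℤ} (h : IsRealizableMod G ℓ q)
    (hq : ∀ v ∈ G.vertexSet, q v ≡ q' v [ZMOD 2 * ℓ]) : IsRealizableMod G ℓ q' :=
  let ⟨r, hrq, hr⟩ := h
  ⟨r, fun v hv => (hrq v hv).trans (hq v hv), hr⟩

theorem IsRealizableMod.of_neg {q : α → ℤ} (h : IsRealizableMod G ℓ (-q)) :
    IsRealizableMod G ℓ q :=
  let ⟨r, hrq, hr⟩ := h
  ⟨-r, fun v hv => by simpa using (hrq v hv).neg, hr.neg⟩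

theorem exists_isBoundary_modEq (hℓ : 0 < ℓ) (hV : G.vertexSet = V) {q : α → ℤ}
    (hpar : ∀ v ∈ V, q v ≡ G.vertexDegree v [ZMOD 2]) (hsum : ∑ v ∈ V, q v ≡ 0 [ZMOD 2 * ℓ]) :
    ∃ b : α → ℕ, G.IsBoundary ℓ b ∧ ∀ v, (b v : ℤ) ≡ q v [ZMOD 2 * ℓ] := by
  have hpos : (0 : ℤ) < 2 * ℓ := by omega
  have hb (v : α) : ((q v % (2 * ℓ)).toNat : ℤ) = q v % (2 * ℓ) :=
    Int.toNat_of_nonneg (Int.emod_nonneg _ hpos.ne')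
  have hbq (v : α) : ((q v % (2 * ℓ)).toNat : ℤ) ≡ q v [ZMOD 2 * ℓ] := by
    rw [hb]
    exact Int.mod_modEq _ _
  refine ⟨fun v => (q v % (2 * ℓ)).toNat, ⟨fun v _ => ?_, fun v hv => ?_, ?_⟩, hbq⟩
  · zify [hb]
    exact Int.emod_lt_of_pos _ hpos
  · rw [hV] at hv
    exact Int.natCast_modEq_iff.1 (((hbq v).of_mul_right _).trans (hpar v hv))
  · rw [hV, finsum_mem_coe_finset, ← Int.natCast_modEq_iff]
    push_cast
    exact (Int.ModEq.sum fun v _ => hbq v).trans hsum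

theorem stronglyZConnected_iff [Finite G.edgeSet] (hℓ : 0 < ℓ) (hV : G.vertexSet = V) :
    G.StronglyZConnected ℓ ↔
      ∀ q : α → ℤ, (∀ v ∈ V, q v ≡ G.vertexDegree v [ZMOD 2]) →
        ∑ v ∈ V, q v ≡ 0 [ZMOD 2 * ℓ] → IsRealizableMod G ℓ q := by
  constructor
  · intro h q hpar hsum
    obtain ⟨b, hb, hbq⟩ := exists_isBoundary_modEq hℓ hV hpar hsum
    obtain ⟨D, hD⟩ := h b hb
    exact ⟨netOutDegree D, fun v hv => (hD v hv).trans (hbq v), isCutBounded_netOutDegree D⟩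
  · intro h b hb
    have hpar (v : α) (hv : v ∈ V) : (b v : ℤ) ≡ G.vertexDegree v [ZMOD 2] :=
      Int.natCast_modEq_iff.2 (hb.parity v (by simpa [hV] using hv))
    have hsum : ∑ v ∈ V, (b v : ℤ) ≡ 0 [ZMOD 2 * ℓ] := by
      have := Int.natCast_modEq_iff.2 hb.sum
      rw [hV, finsum_mem_coe_finset] at this
      exact_mod_cast this
    obtain ⟨r, hrb, hr⟩ := h (fun v => b v) hpar hsum
    have hrpar (v : α) (hv : v ∈ V) : r v ≡ G.vertexDegree v [ZMOD 2] :=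
      ((hrb v (by simpa [hV] using hv)).of_mul_right _).trans (hpar v hv)
    obtain ⟨D, hD⟩ := hr.exists_netOutDegree_eq hV hrpar
    refine ⟨D, fun v hv => ?_⟩
    change netOutDegree D v ≡ b v [ZMOD 2 * ℓ]
    rw [hD v (by simpa [hV] using hv)]
    exact hrb v hv

end Boundary

section Truncation

theorem exists_modEq_mem_Ico {ℓ : ℕ} (hℓ : 0 < ℓ) (q : ℤ) :
    ∃ z : ℤ, z ≡ q [ZMOD 2 * ℓ] ∧ -ℓ ≤ z ∧ z < ℓ := by
  refine ⟨(q + ℓ) % (2 * ℓ) - ℓ, ?_, ?_, ?_⟩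
  · simpa using (Int.mod_modEq (q + ℓ) (2 * ℓ)).sub_right (ℓ : ℤ)
  · have := Int.emod_nonneg (q + ℓ) (b := 2 * ℓ) (by omega)
    omega
  · have := Int.emod_lt_of_pos (q + ℓ) (b := 2 * ℓ) (by omega)
    omega

theorem abs_le_of_modEq_two {z ℓ m : ℤ} (hz : |z| ≤ ℓ) (hm : ℓ - 1 ≤ m) (h : z ≡ m [ZMOD 2]) :
    |z| ≤ m := by
  have := h.dvd
  rw [abs_le] at *
  omega

theorem exists_modEq_add_abs_le {ℓ m n : ℕ} (hℓ : 0 < ℓ) (hmin : min m (ℓ - 1) ≤ n) {f c : ℤ}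
    (hf : |f| ≤ m) (hfm : f ≡ m [ZMOD 2]) (hc : |c| = |(n : ℤ) - m|) :
    ∃ z : ℤ, z ≡ f + c [ZMOD 2 * ℓ] ∧ |z| ≤ n := by
  have hcn : f + c ≡ n [ZMOD 2] := by
    have := hfm.dvd
    rw [Int.modEq_iff_dvd]
    obtain h | h := abs_eq_abs.1 hc <;> omega
  obtain hn | hn := min_le_iff.1 hmin |>.symm
  · obtain ⟨z, hz, hzl, hzu⟩ := exists_modEq_mem_Ico hℓ (f + c)
    exact ⟨z, hz, abs_le_of_modEq_two (abs_le.2 ⟨hzl, hzu.le⟩) (by omega)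
      ((hz.of_mul_right _).trans hcn)⟩
  · refine ⟨f + c, rfl, (abs_add_le f c).trans ?_⟩
    have : |(n : ℤ) - m| = n - m := abs_of_nonneg (by omega)
    omega

theorem exists_antisymm_of_pairwise {s : Set α} {R : α → α → ℤ → Prop}
    (hneg : ∀ ⦃x y z⦄, R x y z → R y x (-z)) (hR : s.Pairwise fun x y => ∃ z, R x y z) :
    ∃ g : α → α → ℤ, (∀ x y, g y x = -g x y) ∧ s.Pairwise fun x y => R x y (g x y) := by
  classical
  let := linearOrderOfSTO (WellOrderingRel (α := α))
  let z (x y : α) : ℤ := Classical.epsilon (R x y)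
  refine ⟨fun x y => if x < y then z x y else if y < x then -z y x else 0, fun x y => ?_, ?_⟩
  · obtain h | rfl | h := lt_trichotomy x y
    · simp [h, h.not_gt]
    · simp
    · simp [h, h.not_gt]
  · intro x hx y hy hxy
    obtain h | h := hxy.lt_or_gt
    · simpa [h] using Classical.epsilon_spec (hR hx hy hxy)
    · simpa [h, h.not_gt] using hneg (Classical.epsilon_spec (hR hy hx hxy.symm))

theorem sum_sum_antisymm {g : α → α → ℤ} (hg : ∀ x y, g y x = -g x y) (S : Finset α) :
    ∑ x ∈ S, ∑ y ∈ S, g x y = 0 := by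
  have h : ∑ x ∈ S, ∑ y ∈ S, g x y = -∑ x ∈ S, ∑ y ∈ S, g x y := by
    conv_lhs => rw [Finset.sum_comm]
    simp only [← Finset.sum_neg_distrib, ← hg]
  linarith

variable {V : Finset α} {ℓ : ℕ} [Finite G.edgeSet]

theorem isCutBounded_sum_antisymm (hV : G.vertexSet = V) {g : α → α → ℤ}
    (hg : ∀ x y, g y x = -g x y)
    (hle : (V : Set α).Pairwise fun x y => |g x y| ≤ G.pairMultiplicity x y) :
    IsCutBounded G fun x => ∑ y ∈ V, g x y := by
  classical
  intro S hS
  rw [hV, Finset.coe_subset] at hS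
  have hsplit (x : α) : ∑ y ∈ V, g x y = ∑ y ∈ V \ S, g x y + ∑ y ∈ S, g x y :=
    (Finset.sum_sdiff hS).symm
  simp only [hsplit]
  rw [Finset.sum_add_distrib, sum_sum_antisymm hg, add_zero, setDegree_eq_sum hV]
  push_cast
  refine (Finset.abs_sum_le_sum_abs _ _).trans (Finset.sum_le_sum fun x hx => ?_)
  refine (Finset.abs_sum_le_sum_abs _ _).trans (Finset.sum_le_sum fun y hy => ?_)
  obtain ⟨hyV, hyS⟩ := Finset.mem_sdiff.1 hy
  exact hle (hS hx) hyV (by rintro rfl; exact hyS hx)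

theorem vertexDegree_eq_sum [G.Loopless] (hV : G.vertexSet = V) {v : α} (hv : v ∈ V) :
    G.vertexDegree v = ∑ w ∈ V, G.pairMultiplicity v w := by
  classical
  have h := setDegree_eq_sum hV {v}
  rw [Finset.coe_singleton, setDegree_singleton, Finset.sum_singleton] at h
  rw [h, ← Finset.sum_sdiff (Finset.singleton_subset_iff.2 hv), Finset.sum_singleton,
    pairMultiplicity_self, add_zero]

theorem netOutDegree_eq_sum (hV : G.vertexSet = V) (D : G.Orientation) (v : α) :
    netOutDegree D v = ∑ w ∈ V, ((arcCount D {v} {w} : ℤ) - arcCount D {w} {v}) := by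
  have hout : D.outDegree v = arcCount D {v} V := by
    rw [outDegree_eq_arcCount, arcCount, arcCount]
    congr 1
    ext e
    simpa [hV] using fun _ => (D.isLink e).right_mem
  have hin : D.inDegree v = arcCount D V {v} := by
    rw [inDegree_eq_arcCount, arcCount, arcCount]
    congr 1
    ext e
    simpa [hV] using fun _ => (D.isLink e).left_mem
  rw [netOutDegree, hout, hin, arcCount_coe_right, arcCount_coe_left, Finset.sum_sub_distrib]
  push_cast
  rfl

theorem exists_antisymm_sum_modEq (hℓ : 0 < ℓ) (hV : G.vertexSet = V)
    (h : G.StronglyZConnected ℓ) {q : α → ℤ} (hpar : ∀ v ∈ V, q v ≡ G.vertexDegree v [ZMOD 2])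
    (hsum : ∑ v ∈ V, q v ≡ 0 [ZMOD 2 * ℓ]) :
    ∃ f : α → α → ℤ, (∀ x y, f y x = -f x y) ∧
      (∀ x y, x ≠ y → |f x y| ≤ G.pairMultiplicity x y ∧
        f x y ≡ G.pairMultiplicity x y [ZMOD 2]) ∧
      ∀ x ∈ V, ∑ y ∈ V, f x y ≡ q x [ZMOD 2 * ℓ] := by
  obtain ⟨b, hb, hbq⟩ := exists_isBoundary_modEq hℓ hV hpar hsum
  obtain ⟨D, hD⟩ := h b hb
  refine ⟨fun x y => arcCount D {x} {y} - arcCount D {y} {x}, fun x y => (neg_sub _ _).symm,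
    fun x y hxy => ?_, fun x hx => ?_⟩
  · dsimp only
    rw [pairMultiplicity, ← arcCount_add_arcCount D (Set.disjoint_singleton.2 hxy), abs_le,
      Int.modEq_iff_dvd]
    omega
  · rw [← netOutDegree_eq_sum hV]
    exact (hD x (by simpa [hV] using hx)).trans (hbq x)

theorem exists_antisymm_abs_eq_sum_modEq {H : Graph α γ} [Finite H.edgeSet] [G.Loopless]
    [H.Loopless] (hG : G.vertexSet = V) (hH : H.vertexSet = V) :
    ∃ c : α → α → ℤ, (∀ x y, c y x = -c x y) ∧
      (V : Set α).Pairwise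
        (fun x y => |c x y| = |(H.pairMultiplicity x y : ℤ) - G.pairMultiplicity x y|) ∧
      ∀ x ∈ V, ∑ y ∈ V, c x y ≡ H.vertexDegree x - G.vertexDegree x [ZMOD 2] := by
  obtain ⟨c, hc, hcabs⟩ := exists_antisymm_of_pairwise
    (s := V) (R := fun x y z => |z| = |(H.pairMultiplicity x y : ℤ) - G.pairMultiplicity x y|)
    (fun x y z hz => by
      rw [abs_neg, hz, pairMultiplicity_comm x y, pairMultiplicity_comm x y])
    (fun x _ y _ _ => ⟨_, rfl⟩)
  refine ⟨c, hc, hcabs, fun x hx => ?_⟩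
  rw [vertexDegree_eq_sum hG hx, vertexDegree_eq_sum hH hx]
  push_cast
  rw [← Finset.sum_sub_distrib]
  refine Int.ModEq.sum fun y hy => ?_
  obtain rfl | hxy := eq_or_ne x y
  · simp [self_eq_neg.1 (hc x x), pairMultiplicity_self]
  · rw [Int.modEq_iff_dvd]
    obtain h | h := abs_eq_abs.1 (hcabs hx hy hxy) <;> omega

theorem stronglyZConnected_of_min_le {H : Graph α γ} [Finite H.edgeSet] [G.Loopless] [H.Loopless]
    (hℓ : 0 < ℓ) (hG : G.vertexSet = V) (hH : H.vertexSet = V)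
    (hle : (V : Set α).Pairwise fun x y =>
      min (G.pairMultiplicity x y) (ℓ - 1) ≤ H.pairMultiplicity x y)
    (h : G.StronglyZConnected ℓ) : H.StronglyZConnected ℓ := by
  refine (stronglyZConnected_iff hℓ hH).2 fun q hpar hsum => ?_
  obtain ⟨c, hc, hcabs, hcpar⟩ := exists_antisymm_abs_eq_sum_modEq hG hH
  have hself {f : α → α → ℤ} (hf : ∀ x y, f y x = -f x y) (x : α) : f x x = 0 :=
    self_eq_neg.1 (hf x x)
  obtain ⟨f, hf, hfle, hfq⟩ := exists_antisymm_sum_modEq hℓ hG h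
    (q := fun x => q x - ∑ y ∈ V, c x y)
    (fun x hx => by simpa using (hpar x hx).sub (hcpar x hx))
    (by simpa [Finset.sum_sub_distrib, sum_sum_antisymm hc] using hsum)
  obtain ⟨g, hg, hgle⟩ := exists_antisymm_of_pairwise (s := V)
    (R := fun x y z => z ≡ f x y + c x y [ZMOD 2 * ℓ] ∧ |z| ≤ H.pairMultiplicity x y)
    (fun x y z hz => by
      rw [hf x y, hc x y, ← neg_add, abs_neg, pairMultiplicity_comm]
      exact ⟨hz.1.neg, hz.2⟩)
    (fun x hx y hy hxy => exists_modEq_add_abs_le hℓ (hle hx hy hxy) (hfle x y hxy).1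
      (hfle x y hxy).2 (hcabs hx hy hxy))
  refine ⟨fun x => ∑ y ∈ V, g x y, fun x hx => ?_, isCutBounded_sum_antisymm hH hg
    fun x hx y hy hxy => (hgle hx hy hxy).2⟩
  have hx' : x ∈ V := by simpa [hH] using hx
  calc ∑ y ∈ V, g x y
      ≡ ∑ y ∈ V, (f x y + c x y) [ZMOD 2 * ℓ] := Int.ModEq.sum fun y hy => by
        obtain rfl | hxy := eq_or_ne x y
        · simp [hself hc, hself hf, hself hg]
        · exact (hgle hx' hy hxy).1
    _ = ∑ y ∈ V, f x y + ∑ y ∈ V, c x y := Finset.sum_add_distrib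
    _ ≡ q x [ZMOD 2 * ℓ] := by simpa using (hfq x hx').add_right (∑ y ∈ V, c x y)

theorem stronglyZConnected_iff_of_isSimplifiedGraph {H : Graph α γ} [G.Loopless] (hℓ : 0 < ℓ)
    (hV : G.vertexSet = V) (hH : IsSimplifiedGraph ℓ G H) :
    G.StronglyZConnected ℓ ↔ H.StronglyZConnected ℓ := by
  have := hH.loopless
  have := hH.edgeSet_finite.to_subtype
  have hVH := hH.vertexSet_eq.trans hV
  have hmul := hH.pairMultiplicity_eq
  simp only [hV] at hmul
  constructor
  · exact stronglyZConnected_of_min_le hℓ hV hVH fun x hx y hy hxy => (hmul x hx y hy hxy).ge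
  · refine stronglyZConnected_of_min_le hℓ hVH hV fun x hx y hy hxy => ?_
    exact (min_le_left _ _).trans ((hmul x hx y hy hxy).le.trans (min_le_left _ _))

end Truncation

section Necessity

variable {ℓ : ℕ} {V : Finset α} [Finite G.edgeSet]

theorem exists_isCutBounded_le (hℓ : 0 < ℓ) (hV : G.vertexSet = V)
    (h : G.StronglyZConnected ℓ) {w : α} (hw : w ∈ V) :
    ∃ r : α → ℤ, IsCutBounded G r ∧
      ∀ v ∈ V, v ≠ w → r v ≤ G.vertexDegree v - 2 * ((ℓ : ℤ) - 1) := by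
  classical
  -- Away from `w` the demand exceeds the degree by two, so it has to be lowered by at least `2ℓ`.
  let q (v : α) : ℤ := G.vertexDegree v + 2 * (1 - if v = w then (G.numEdges + V.card : ℤ) else 0)
  have hsum : ∑ v ∈ V, q v = 0 := by
    have hdeg : (∑ v ∈ V, G.vertexDegree v : ℤ) = 2 * G.numEdges := by
      exact_mod_cast sum_vertexDegree_vertexSet hV
    simp only [q, Finset.sum_add_distrib, ← Finset.mul_sum, Finset.sum_sub_distrib, hdeg,
      Finset.sum_ite_eq', hw, if_true, Finset.sum_const, nsmul_eq_mul]
    ring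
  obtain ⟨r, hrq, hr⟩ := (stronglyZConnected_iff hℓ hV).1 h q
    (fun v _ => by simp [q, Int.modEq_iff_dvd]) (by rw [hsum])
  refine ⟨r, hr, fun v hv hvw => ?_⟩
  replace hv : v ∈ G.vertexSet := by simpa [hV] using hv
  have hle : r v ≤ G.vertexDegree v := (le_abs_self _).trans (hr.abs_le hv)
  have hdvd : (2 * ℓ : ℤ) ∣ G.vertexDegree v + 2 - r v := by
    simpa [q, hvw] using (hrq v hv).dvd
  have := Int.le_of_dvd (by linarith) hdvd
  linarith

theorem le_vertexDegree_of_stronglyZConnected (hℓ : 0 < ℓ) (hV : G.vertexSet = V)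
    (hcard : 1 < V.card) (h : G.StronglyZConnected ℓ) {v : α} (hv : v ∈ V) :
    ℓ - 1 ≤ G.vertexDegree v := by
  obtain ⟨w, hw, hwv⟩ := Finset.exists_mem_ne hcard v
  obtain ⟨r, hr, hrle⟩ := exists_isCutBounded_le hℓ hV h hw
  have hlower := (abs_le.1 (hr.abs_le (v := v) (by simpa [hV] using hv))).1
  have hupper := hrle v hv hwv.symm
  omega

theorem mul_le_numEdges_of_stronglyZConnected (hℓ : 0 < ℓ) (hV : G.vertexSet = V)
    (h : G.StronglyZConnected ℓ) : (V.card - 1) * (ℓ - 1) ≤ G.numEdges := by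
  classical
  obtain rfl | ⟨w, hw⟩ := V.eq_empty_or_nonempty
  · simp
  obtain ⟨r, hr, hrle⟩ := exists_isCutBounded_le hℓ hV h hw
  have hrw : r w ≤ G.vertexDegree w :=
    (le_abs_self _).trans (hr.abs_le (by simpa [hV] using hw))
  have hsum := calc
    0 = ∑ v ∈ V.erase w, r v + r w := by
      rw [Finset.sum_erase_add _ _ hw, hr.sum_eq_zero hV]
    _ ≤ ∑ v ∈ V.erase w, (G.vertexDegree v - 2 * ((ℓ : ℤ) - 1)) + G.vertexDegree w :=
      add_le_add (Finset.sum_le_sum fun v hv =>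
        hrle v (Finset.mem_of_mem_erase hv) (Finset.ne_of_mem_erase hv)) hrw
    _ = ∑ v ∈ V, (G.vertexDegree v : ℤ) - (V.erase w).card * (2 * ((ℓ : ℤ) - 1)) := by
      rw [← Finset.sum_erase_add _ _ hw, Finset.sum_sub_distrib, Finset.sum_const, nsmul_eq_mul]
      ring
    _ = 2 * (G.numEdges - (V.erase w).card * ((ℓ : ℤ) - 1)) := by
      rw [← Nat.cast_sum, sum_vertexDegree_vertexSet hV]
      push_cast
      ring
  rw [← Finset.card_erase_of_mem hw]
  zify [Nat.one_le_iff_ne_zero.2 hℓ.ne']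
  linarith

theorem exists_two_mul_le_setDegree_of_stronglyZConnected (hℓ : 0 < ℓ) (hV : G.vertexSet = V)
    (hcard : 2 < V.card) (heven : Even V.card) (h : G.StronglyZConnected ℓ)
    (hdeg : ∀ v ∈ V, G.vertexDegree v ≡ ℓ [MOD 2]) :
    ∃ x ∈ V, ∃ y ∈ V, x ≠ y ∧ 2 * ℓ ≤ G.setDegree {x, y} := by
  classical
  by_contra! hlt
  obtain ⟨k, hk⟩ := heven
  obtain ⟨r, hrℓ, hr⟩ := (stronglyZConnected_iff hℓ hV).1 h (fun _ => ℓ)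
    (fun v hv => Int.natCast_modEq_iff.2 (hdeg v hv).symm) <| by
      rw [Finset.sum_const, hk, nsmul_eq_mul, Int.modEq_zero_iff_dvd]
      exact ⟨k, by push_cast; ring⟩
  simp only [hV, Finset.mem_coe] at hrℓ
  have hpair {x y : α} (hx : x ∈ V) (hy : y ∈ V) (hxy : x ≠ y) : r x + r y = 0 := by
    refine Int.eq_zero_of_abs_lt_dvd (m := 2 * ℓ) ?_ ?_
    · simpa [two_mul] using ((hrℓ x hx).add (hrℓ y hy)).symm.dvd
    · have hS := hr {x, y} (by simp [hV, Set.insert_subset_iff, hx, hy])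
      rw [Finset.sum_pair hxy, Finset.coe_pair] at hS
      exact hS.trans_lt (mod_cast hlt x hx y hy hxy)
  obtain ⟨x, hx, y, hy, z, hz, hxy, hxz, hyz⟩ := Finset.two_lt_card.1 hcard
  have h0 : r x = 0 := by linarith [hpair hx hy hxy, hpair hx hz hxz, hpair hy hz hyz]
  have hdvd := h0 ▸ (hrℓ x hx).dvd
  have := Int.le_of_dvd (by omega) hdvd
  omega

end Necessity

section FewVertices

variable {V : Finset α} [Finite G.edgeSet]

theorem setDegree_sdiff [DecidableEq α] (hV : G.vertexSet = V) {S : Finset α} (hS : S ⊆ V) :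
    G.setDegree ↑(V \ S) = G.setDegree S := by
  rw [setDegree_eq_sum hV, setDegree_eq_sum hV, Finset.sdiff_sdiff_eq_self hS, Finset.sum_comm]
  simp only [pairMultiplicity_comm]

theorem isCutBounded_of_card_le_five (hV : G.vertexSet = V) (hcard : V.card ≤ 5) {r : α → ℤ}
    (hsum : ∑ v ∈ V, r v = 0) (hvertex : ∀ v ∈ V, |r v| ≤ G.setDegree {v})
    (hpair : ∀ x ∈ V, ∀ y ∈ V, x ≠ y → |r x + r y| ≤ G.setDegree {x, y}) :
    IsCutBounded G r := by
  classical
  have hsmall {S : Finset α} (hS : S ⊆ V) (hcard : S.card ≤ 2) :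
      |∑ v ∈ S, r v| ≤ G.setDegree S := by
    obtain h | h | h : S.card = 0 ∨ S.card = 1 ∨ S.card = 2 := by omega
    · simp [Finset.card_eq_zero.1 h]
    · obtain ⟨v, rfl⟩ := Finset.card_eq_one.1 h
      simpa using hvertex v (hS (Finset.mem_singleton_self v))
    · obtain ⟨x, y, hxy, rfl⟩ := Finset.card_eq_two.1 h
      rw [Finset.sum_pair hxy, Finset.coe_pair]
      exact hpair x (hS (by simp)) y (hS (by simp)) hxy
  intro S hS
  rw [hV, Finset.coe_subset] at hS
  obtain h | h : S.card ≤ 2 ∨ (V \ S).card ≤ 2 := by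
    rw [Finset.card_sdiff_of_subset hS]
    omega
  · exact hsmall hS h
  · have hcompl : ∑ v ∈ S, r v = -∑ v ∈ V \ S, r v := by
      linarith [Finset.sum_sdiff (f := r) hS]
    rw [hcompl, abs_neg, ← setDegree_sdiff hV hS]
    exact hsmall Finset.sdiff_subset h

end FewVertices

section FourVertices

/-- `a`, `b`, `c`, `d` are the vertices of `G`, without repetition. -/
structure IsVertexList (G : Graph α β) (a b c d : α) : Prop where
  nodup : [a, b, c, d].Nodup
  vertexSet_eq : G.vertexSet = {a, b, c, d}

namespace IsVertexList

variable {a b c d : α}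

theorem swap (h : IsVertexList G a b c d) : IsVertexList G b a c d where
  nodup := (List.Perm.swap _ _ _).nodup_iff.1 h.nodup
  vertexSet_eq := h.vertexSet_eq.trans (Set.insert_comm _ _ _)

theorem rotate (h : IsVertexList G a b c d) : IsVertexList G b c d a where
  nodup := (List.perm_append_comm (l₁ := [a]) (l₂ := [b, c, d])).nodup_iff.1 h.nodup
  vertexSet_eq := h.vertexSet_eq.trans (by grind)

theorem swap_pairs (h : IsVertexList G a b c d) : IsVertexList G c d a b := h.rotate.rotate

theorem swap_right (h : IsVertexList G a b c d) : IsVertexList G a b d c :=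
  h.swap_pairs.swap.swap_pairs

theorem swap_middle (h : IsVertexList G a b c d) : IsVertexList G a c b d :=
  h.rotate.swap.rotate.rotate.rotate

theorem exists_of_ncard_eq_four (h : G.vertexSet.ncard = 4) :
    ∃ a b c d, IsVertexList G a b c d := by
  obtain ⟨a, b, c, d, hab, hac, had, hbc, hbd, hcd, hV⟩ := Set.ncard_eq_four.1 h
  exact ⟨a, b, c, d, by simp [*], hV⟩

theorem mem (h : IsVertexList G a b c d) : a ∈ G.vertexSet := by
  simp [h.vertexSet_eq]

theorem forall_mem_iff (h : IsVertexList G a b c d) {p : α → Prop} :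
    (∀ v ∈ G.vertexSet, p v) ↔ p a ∧ p b ∧ p c ∧ p d := by
  simp [h.vertexSet_eq]

theorem ne (h : IsVertexList G a b c d) : a ≠ b := by
  have := h.nodup
  grind

theorem exists_of_mem (h : IsVertexList G a b c d) {x : α} (hx : x ∈ G.vertexSet) :
    ∃ y z w, IsVertexList G x y z w := by
  rw [h.vertexSet_eq] at hx
  obtain rfl | rfl | rfl | rfl := hx
  exacts [⟨_, _, _, h⟩, ⟨_, _, _, h.rotate⟩, ⟨_, _, _, h.swap_pairs⟩,
    ⟨_, _, _, h.swap_pairs.rotate⟩]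

theorem exists_of_ne (h : IsVertexList G a b c d) {x y : α} (hx : x ∈ G.vertexSet)
    (hy : y ∈ G.vertexSet) (hxy : x ≠ y) : ∃ z w, IsVertexList G x y z w := by
  obtain ⟨p, q, s, h⟩ := h.exists_of_mem hx
  rw [h.vertexSet_eq] at hy
  obtain rfl | rfl | rfl | rfl := hy
  exacts [absurd rfl hxy, ⟨_, _, h⟩, ⟨_, _, h.swap_middle⟩, ⟨_, _, h.swap_right.swap_middle⟩]

theorem sum_eq [DecidableEq α] {M : Type*} [AddCommMonoid M] (h : IsVertexList G a b c d)
    (f : α → M) : ∑ v ∈ {a, b, c, d}, f v = f a + f b + f c + f d := by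
  have := h.nodup
  rw [Finset.sum_insert (by grind), Finset.sum_insert (by grind), Finset.sum_pair (by grind)]
  simp only [add_assoc]

theorem vertexSet_eq_coe [DecidableEq α] (h : IsVertexList G a b c d) :
    G.vertexSet = ({a, b, c, d} : Finset α) := by
  simp [h.vertexSet_eq]

variable [Finite G.edgeSet]

theorem setDegree_pair (h : IsVertexList G a b c d) :
    G.setDegree {a, b} = G.pairMultiplicity a c + G.pairMultiplicity a d +
      G.pairMultiplicity b c + G.pairMultiplicity b d := by
  classical
  have hV := setDegree_eq_sum h.vertexSet_eq_coe {a, b}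
  have hsdiff : ({a, b, c, d} : Finset α) \ {a, b} = {c, d} := by
    have := h.nodup
    grind
  rw [hsdiff, Finset.sum_pair h.ne, Finset.sum_pair h.swap_pairs.ne,
    Finset.sum_pair h.swap_pairs.ne, Finset.coe_pair] at hV
  rw [hV, add_assoc, add_assoc, add_assoc]

theorem setDegree_pair_compl (h : IsVertexList G a b c d) :
    G.setDegree {c, d} = G.setDegree {a, b} := by
  rw [h.setDegree_pair, h.swap_pairs.setDegree_pair]
  simp only [pairMultiplicity_comm c, pairMultiplicity_comm d]
  ring

theorem sum_vertexDegree_eq (h : IsVertexList G a b c d) :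
    G.vertexDegree a + G.vertexDegree b + G.vertexDegree c + G.vertexDegree d =
      2 * G.numEdges := by
  classical
  rw [← h.sum_eq, sum_vertexDegree_vertexSet h.vertexSet_eq_coe]

variable [G.Loopless]

theorem vertexDegree_eq (h : IsVertexList G a b c d) :
    G.vertexDegree a =
      G.pairMultiplicity a b + G.pairMultiplicity a c + G.pairMultiplicity a d := by
  classical
  rw [vertexDegree_eq_sum h.vertexSet_eq_coe (by simp), h.sum_eq, pairMultiplicity_self, zero_add]

theorem vertexDegree_add_vertexDegree (h : IsVertexList G a b c d) :
    G.vertexDegree a + G.vertexDegree b = G.setDegree {a, b} + 2 * G.pairMultiplicity a b := by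
  rw [h.vertexDegree_eq, h.swap.vertexDegree_eq, h.setDegree_pair, pairMultiplicity_comm b a]
  ring

theorem numEdges_eq (h : IsVertexList G a b c d) :
    G.numEdges = G.setDegree {a, b} + G.pairMultiplicity a b + G.pairMultiplicity c d := by
  have h₁ := h.vertexDegree_add_vertexDegree
  have h₂ := h.swap_pairs.vertexDegree_add_vertexDegree
  have h₃ := h.sum_vertexDegree_eq
  have h₄ := h.setDegree_pair_compl
  omega

theorem sum_setDegree_pair (h : IsVertexList G a b c d) :
    G.setDegree {a, b} + G.setDegree {a, c} + G.setDegree {a, d} = 2 * G.numEdges := by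
  rw [h.numEdges_eq, h.setDegree_pair, h.swap_middle.setDegree_pair,
    h.swap_right.swap_middle.setDegree_pair, pairMultiplicity_comm c b, pairMultiplicity_comm d b,
    pairMultiplicity_comm d c]
  ring

end IsVertexList

end FourVertices

section Sufficiency

variable {ℓ : ℕ} {r : α → ℤ} {a b c d : α}

/-- The degree, edge and multiplicity bounds satisfied by a four-vertex graph that is simplified
with respect to `ℓ` and meets the first two conditions of the characterization. -/
structure IsDense (G : Graph α β) (ℓ : ℕ) : Prop where
  pairMultiplicity_le : ∀ x ∈ G.vertexSet, ∀ y ∈ G.vertexSet, x ≠ y →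
    G.pairMultiplicity x y ≤ ℓ - 1
  le_vertexDegree : ∀ v ∈ G.vertexSet, ℓ - 1 ≤ G.vertexDegree v
  le_numEdges : 3 * ℓ - 3 ≤ G.numEdges

/-- `r` has the parity of the degrees of `G` and values of least absolute value modulo `2ℓ`. -/
structure IsReduced (G : Graph α β) (ℓ : ℕ) (r : α → ℤ) : Prop where
  modEq : ∀ v ∈ G.vertexSet, r v ≡ G.vertexDegree v [ZMOD 2]
  abs_le : ∀ v ∈ G.vertexSet, |r v| ≤ ℓ

/-- The demand of `r` on `{x, y}` exceeds the capacity of the cut of `{x, y}`. -/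
def IsOverloaded (G : Graph α β) (r : α → ℤ) (x y : α) : Prop :=
  (G.setDegree {x, y} : ℤ) < r x + r y

theorem isOverloaded_comm {x y : α} : IsOverloaded G r x y ↔ IsOverloaded G r y x := by
  rw [IsOverloaded, IsOverloaded, Set.pair_comm, add_comm]

theorem IsReduced.neg (hr : IsReduced G ℓ r) : IsReduced G ℓ (-r) where
  modEq v hv := by
    have := (hr.modEq v hv).dvd
    rw [Int.modEq_iff_dvd, Pi.neg_apply]
    omega
  abs_le v hv := by simpa using hr.abs_le v hv

theorem IsReduced.abs_le_vertexDegree (hr : IsReduced G ℓ r) (hG : IsDense G ℓ) {v : α}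
    (hv : v ∈ G.vertexSet) : |r v| ≤ G.vertexDegree v :=
  abs_le_of_modEq_two (hr.abs_le v hv) (by have := hG.le_vertexDegree v hv; omega)
    (hr.modEq v hv)

namespace IsVertexList

variable [Finite G.edgeSet] [G.Loopless] (h : IsVertexList G a b c d)

include h

theorem isCutBounded (hsum : r a + r b + r c + r d = 0)
    (hvertex : ∀ v ∈ G.vertexSet, |r v| ≤ G.vertexDegree v)
    (hab : |r a + r b| ≤ G.setDegree {a, b}) (hac : |r a + r c| ≤ G.setDegree {a, c})
    (had : |r a + r d| ≤ G.setDegree {a, d}) : IsCutBounded G r := by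
  classical
  have hcompl {x y z w : α} (h : IsVertexList G x y z w) (hsum : r x + r y + r z + r w = 0)
      (hxy : |r x + r y| ≤ G.setDegree {x, y}) : |r z + r w| ≤ G.setDegree {z, w} := by
    rwa [h.setDegree_pair_compl, show r z + r w = -(r x + r y) by linarith, abs_neg]
  have hcd := hcompl h hsum hab
  have hbd := hcompl h.swap_middle (by linarith) hac
  have hbc := hcompl h.swap_right.swap_middle (by linarith) had
  refine isCutBounded_of_card_le_five h.vertexSet_eq_coe Finset.card_le_four.step
    (by rw [h.sum_eq, hsum]) (fun v hv => ?_) fun x hx y hy hxy => ?_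
  · rw [setDegree_singleton]
    exact hvertex v (by simpa [h.vertexSet_eq] using hv)
  · simp only [Finset.mem_insert, Finset.mem_singleton] at hx hy
    obtain rfl | rfl | rfl | rfl := hx <;> obtain rfl | rfl | rfl | rfl := hy <;>
      first
      | exact absurd rfl hxy
      | assumption
      | rw [add_comm, Set.pair_comm]; assumption

theorem isRealizableMod (i j k l : ℤ)
    (hsum : r a + r b + r c + r d + 2 * ℓ * (i + j + k + l) = 0)
    (ha : |r a + 2 * ℓ * i| ≤ G.vertexDegree a) (hb : |r b + 2 * ℓ * j| ≤ G.vertexDegree b)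
    (hc : |r c + 2 * ℓ * k| ≤ G.vertexDegree c) (hd : |r d + 2 * ℓ * l| ≤ G.vertexDegree d)
    (hab : |r a + r b + 2 * ℓ * (i + j)| ≤ G.setDegree {a, b})
    (hac : |r a + r c + 2 * ℓ * (i + k)| ≤ G.setDegree {a, c})
    (had : |r a + r d + 2 * ℓ * (i + l)| ≤ G.setDegree {a, d}) :
    IsRealizableMod G ℓ r := by
  classical
  let shift (v : α) : ℤ := if v = a then i else if v = b then j else if v = c then k else l
  let r' (v : α) : ℤ := r v + 2 * ℓ * shift v
  have hra : r' a = r a + 2 * ℓ * i := by simp [r', shift]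
  have hrb : r' b = r b + 2 * ℓ * j := by simp [r', shift, h.ne.symm]
  have hrc : r' c = r c + 2 * ℓ * k := by simp [r', shift, h.swap_middle.ne.symm, h.rotate.ne.symm]
  have hrd : r' d = r d + 2 * ℓ * l := by
    simp [r', shift, h.swap_pairs.ne.symm, h.rotate.swap_middle.ne.symm,
      h.swap_right.swap_middle.ne.symm]
  refine ⟨r', fun v _ => Int.add_mul_emod_self_left _ _ _, h.isCutBounded ?_ ?_ ?_ ?_ ?_⟩
  · rw [hra, hrb, hrc, hrd, ← hsum]
    ring
  · rw [h.forall_mem_iff, hra, hrb, hrc, hrd]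
    exact ⟨ha, hb, hc, hd⟩
  · rwa [hra, hrb, add_add_add_comm, ← mul_add]
  · rwa [hra, hrc, add_add_add_comm, ← mul_add]
  · rwa [hra, hrd, add_add_add_comm, ← mul_add]

end IsVertexList

namespace IsDense

variable [Finite G.edgeSet] [G.Loopless] (hG : IsDense G ℓ) (h : IsVertexList G a b c d)

include hG h

theorem le_setDegree_pair : ℓ - 1 ≤ G.setDegree {a, b} := by
  have := h.numEdges_eq
  have := hG.pairMultiplicity_le a h.mem b h.swap.mem h.ne
  have := hG.pairMultiplicity_le c h.swap_pairs.mem d h.swap_pairs.swap.mem h.swap_pairs.ne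
  have := hG.le_numEdges
  omega

theorem le_vertexDegree_add_add_setDegree :
    4 * (ℓ - 1) ≤ G.vertexDegree a + G.vertexDegree b + G.setDegree {a, b} := by
  have := h.numEdges_eq
  have := h.vertexDegree_add_vertexDegree
  have := hG.pairMultiplicity_le c h.swap_pairs.mem d h.swap_pairs.swap.mem h.swap_pairs.ne
  have := hG.le_numEdges
  omega

theorem le_sum_setDegree_pair :
    6 * (ℓ - 1) ≤ G.setDegree {a, b} + G.setDegree {a, c} + G.setDegree {a, d} := by
  have := h.sum_setDegree_pair
  have := hG.le_numEdges
  omega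

theorem le_setDegree_add_setDegree :
    3 * (ℓ - 1) ≤ G.setDegree {a, b} + G.setDegree {a, c} := by
  have := h.sum_setDegree_pair
  have := h.swap_right.swap_middle.numEdges_eq
  have := hG.le_numEdges
  omega

theorem le_vertexDegree_add_add_setDegree_add :
    6 * (ℓ - 1) ≤
      G.vertexDegree a + G.vertexDegree d + G.setDegree {a, b} + G.setDegree {a, c} := by
  have := h.sum_setDegree_pair
  have := h.swap_right.swap_middle.vertexDegree_add_vertexDegree
  have := hG.le_numEdges
  omega

end IsDense

theorem IsReduced.even_vertexDegree_add (hr : IsReduced G ℓ r) {v : α} (hv : v ∈ G.vertexSet) :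
    2 ∣ G.vertexDegree v + r v := by
  have := (hr.modEq v hv).dvd
  omega

variable [Finite G.edgeSet] [G.Loopless] (h : IsVertexList G a b c d) (hr : IsReduced G ℓ r)

include h hr

theorem even_setDegree_pair_add : 2 ∣ G.setDegree {a, b} + r a + r b := by
  have := h.vertexDegree_add_vertexDegree
  have := hr.even_vertexDegree_add h.mem
  have := hr.even_vertexDegree_add h.swap.mem
  omega

theorem isOverloaded_iff : IsOverloaded G r a b ↔ G.setDegree {a, b} + 2 ≤ r a + r b := by
  have := even_setDegree_pair_add h hr
  rw [IsOverloaded]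
  omega

variable (hG : IsDense G ℓ)

include hG

theorem IsOverloaded.not_isOverloaded_compl (hsum : r a + r b + r c + r d ≤ 2 * ℓ)
    (hab : IsOverloaded G r a b) : ¬IsOverloaded G r c d := by
  rw [isOverloaded_iff h hr] at hab
  rw [isOverloaded_iff h.swap_pairs hr, h.setDegree_pair_compl]
  have := hG.le_setDegree_pair h
  omega

theorem IsOverloaded.not_isOverloaded_of_neg_lt (hd : -ℓ < r d)
    (hsum : r a + r b + r c + r d ≤ 2 * ℓ) (hab : IsOverloaded G r a b)
    (hac : IsOverloaded G r a c) : ¬IsOverloaded G r b c := by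
  rw [isOverloaded_iff h hr] at hab
  rw [isOverloaded_iff h.swap_middle hr] at hac
  rw [isOverloaded_iff h.rotate hr]
  have := hG.le_sum_setDegree_pair h
  have := h.swap_right.swap_middle.setDegree_pair_compl
  omega

variable (hsum : r a + r b + r c + r d = 2 * ℓ)

include hsum

theorem isRealizableMod_of_le_add (ha : 2 * ℓ ≤ G.vertexDegree a + r a)
    (hbc : ¬IsOverloaded G r b c) (hbd : ¬IsOverloaded G r b d) (hcd : ¬IsOverloaded G r c d) :
    IsRealizableMod G ℓ r := by
  obtain ⟨hra, hrb, hrc, hrd⟩ := h.forall_mem_iff.1 hr.abs_le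
  obtain ⟨-, hdb, hdc, hdd⟩ := h.forall_mem_iff.1 fun v => hr.abs_le_vertexDegree hG
  have hab := h.setDegree_pair_compl
  have hac := h.swap_middle.setDegree_pair_compl
  have had := h.swap_right.swap_middle.setDegree_pair_compl
  simp only [IsOverloaded, not_lt, abs_le] at *
  refine h.isRealizableMod (-1) 0 0 0 (by omega) ?_ ?_ ?_ ?_ ?_ ?_ ?_ <;> rw [abs_le] <;> omega

theorem isRealizableMod_of_isOverloaded_of_isOverloaded_of_le_add (hd : -ℓ < r d)
    (ha : 2 * ℓ ≤ G.vertexDegree a + r a) (hab : IsOverloaded G r a b)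
    (hac : IsOverloaded G r a c) : IsRealizableMod G ℓ r :=
  isRealizableMod_of_le_add h hr hG hsum ha
    (hab.not_isOverloaded_of_neg_lt h hr hG hd hsum.le hac)
    (hac.not_isOverloaded_compl h.swap_middle hr hG (by omega))
    (hab.not_isOverloaded_compl h hr hG hsum.le)

theorem isRealizableMod_of_isOverloaded_of_isOverloaded (hd : -ℓ < r d)
    (hab : IsOverloaded G r a b) (hac : IsOverloaded G r a c) : IsRealizableMod G ℓ r := by
  by_cases ha : 2 * ℓ ≤ G.vertexDegree a + r a
  · exact isRealizableMod_of_isOverloaded_of_isOverloaded_of_le_add h hr hG hsum hd ha hab hac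
  rw [isOverloaded_iff h hr] at hab
  rw [isOverloaded_iff h.swap_middle hr] at hac
  have hda := hG.le_vertexDegree a h.mem
  have hpa := hr.even_vertexDegree_add h.mem
  obtain ⟨hra, hrb, hrc, hrd⟩ := h.forall_mem_iff.1 hr.abs_le
  rw [abs_le] at hra hrb hrc hrd
  have hcut := hG.le_sum_setDegree_pair h
  have hcab := hG.le_setDegree_pair h
  have hcac := hG.le_setDegree_pair h.swap_middle
  have hdb := hG.le_vertexDegree_add_add_setDegree h
  have hdc := hG.le_vertexDegree_add_add_setDegree h.swap_middle
  have hdd := hG.le_vertexDegree_add_add_setDegree_add h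
  -- The degree of `a` is too small to lower `r a`; lowering `r b` and `r c` relieves both cuts.
  refine h.isRealizableMod 0 (-1) (-1) 1 (by omega) ?_ ?_ ?_ ?_ ?_ ?_ ?_ <;> rw [abs_le] <;>
    omega

theorem isRealizableMod_of_isOverloaded_of_le_add (hlt : ∀ v ∈ G.vertexSet, -ℓ < r v)
    (ha : 2 * ℓ ≤ G.vertexDegree a + r a) (hab : IsOverloaded G r a b) :
    IsRealizableMod G ℓ r := by
  obtain ⟨-, -, hc, hd⟩ := h.forall_mem_iff.1 hlt
  have hba := isOverloaded_comm.1 hab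
  by_cases hbc : IsOverloaded G r b c
  · exact isRealizableMod_of_isOverloaded_of_isOverloaded h.swap hr hG (by omega) hd hba hbc
  by_cases hbd : IsOverloaded G r b d
  · exact isRealizableMod_of_isOverloaded_of_isOverloaded h.swap.swap_right hr hG (by omega) hc
      hba hbd
  exact isRealizableMod_of_le_add h hr hG hsum ha hbc hbd
    (hab.not_isOverloaded_compl h hr hG hsum.le)

theorem isRealizableMod_of_isOverloaded (hlt : ∀ v ∈ G.vertexSet, -ℓ < r v)
    (hab : IsOverloaded G r a b) : IsRealizableMod G ℓ r := by
  obtain ha | hb : 2 * ℓ ≤ G.vertexDegree a + r a ∨ 2 * ℓ ≤ G.vertexDegree b + r b := by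
    have := (isOverloaded_iff h hr).1 hab
    have := hG.le_vertexDegree_add_add_setDegree h
    have := hr.even_vertexDegree_add h.mem
    have := hr.even_vertexDegree_add h.swap.mem
    omega
  · exact isRealizableMod_of_isOverloaded_of_le_add h hr hG hsum hlt ha hab
  · exact isRealizableMod_of_isOverloaded_of_le_add h.swap hr hG (by omega) hlt hb
      (isOverloaded_comm.1 hab)

omit h hsum

omit [G.Loopless] in
theorem exists_isVertexList_le_add (h : IsVertexList G a b c d)
    (hsum : r a + r b + r c + r d = 2 * ℓ) :
    ∃ x y z w, IsVertexList G x y z w ∧ r x + r y + r z + r w = 2 * ℓ ∧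
      2 * ℓ ≤ G.vertexDegree x + r x := by
  have hdeg := h.sum_vertexDegree_eq
  have hedges := hG.le_numEdges
  obtain ⟨hpa, hpb, hpc, hpd⟩ := h.forall_mem_iff.1 fun v => hr.even_vertexDegree_add
  by_contra! hlt
  have ha := hlt a b c d h (by omega)
  have hb := hlt b c d a h.rotate (by omega)
  have hc := hlt c d a b h.swap_pairs (by omega)
  have hd := hlt d a b c h.swap_pairs.rotate (by omega)
  omega

theorem isRealizableMod_of_sum_eq_two_mul (h : IsVertexList G a b c d)
    (hsum : r a + r b + r c + r d = 2 * ℓ) (hlt : ∀ v ∈ G.vertexSet, -ℓ < r v) :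
    IsRealizableMod G ℓ r := by
  obtain ⟨x, y, z, w, h, hsum, hx⟩ := exists_isVertexList_le_add hr hG h hsum
  by_cases hyz : IsOverloaded G r y z
  · exact isRealizableMod_of_isOverloaded h.rotate hr hG (by omega) hlt hyz
  by_cases hyw : IsOverloaded G r y w
  · exact isRealizableMod_of_isOverloaded h.swap_right.rotate hr hG (by omega) hlt hyw
  by_cases hzw : IsOverloaded G r z w
  · exact isRealizableMod_of_isOverloaded h.swap_pairs hr hG (by omega) hlt hzw
  exact isRealizableMod_of_le_add h hr hG hsum hx hyz hyw hzw

theorem isRealizableMod_of_transfer (h : IsVertexList G a b c d)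
    (hsum : r a + r b + r c + r d = 0) (hab : IsOverloaded G r a b)
    (ha : 2 * ℓ ≤ G.vertexDegree a + r a) (hc : 2 * ℓ ≤ G.vertexDegree c - r c)
    (had : 2 * ℓ ≤ G.setDegree {a, d} + r a + r d) : IsRealizableMod G ℓ r := by
  obtain ⟨hra, hrb, hrc, hrd⟩ := h.forall_mem_iff.1 hr.abs_le
  obtain ⟨-, hdb, -, hdd⟩ := h.forall_mem_iff.1 fun v => hr.abs_le_vertexDegree hG
  have hcut := hG.le_setDegree_pair h
  have hcuta := hG.le_setDegree_add_setDegree h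
  have hac := h.swap_middle.setDegree_pair_compl
  rw [isOverloaded_iff h hr] at hab
  rw [abs_le] at *
  refine h.isRealizableMod (-1) 0 1 0 (by omega) ?_ ?_ ?_ ?_ ?_ ?_ ?_ <;> rw [abs_le] <;> omega

theorem isRealizableMod_of_le_add_of_le_sub (h : IsVertexList G a b c d)
    (hsum : r a + r b + r c + r d = 0) (hab : IsOverloaded G r a b) (hlt : r a + r b < 2 * ℓ)
    (ha : 2 * ℓ ≤ G.vertexDegree a + r a) (hc : 2 * ℓ ≤ G.vertexDegree c - r c) :
    IsRealizableMod G ℓ r := by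
  by_cases had : 2 * ℓ ≤ G.setDegree {a, d} + r a + r d
  · exact isRealizableMod_of_transfer hr hG h hsum hab ha hc had
  have hba := isOverloaded_comm.1 hab
  have hle := (isOverloaded_iff h hr).1 hab
  have hcut := hG.le_sum_setDegree_pair h
  have hbd_eq := h.swap_middle.setDegree_pair_compl
  have hbc_eq := h.swap_right.swap_middle.setDegree_pair_compl
  have hac_even := even_setDegree_pair_add h.swap_middle hr
  have had_even := even_setDegree_pair_add h.swap_right.swap_middle hr
  have hb_even := hr.even_vertexDegree_add h.swap.mem
  have hd_even := hr.even_vertexDegree_add h.swap_pairs.swap.mem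
  by_cases hb : 2 * ℓ ≤ G.vertexDegree b + r b
  · by_cases hbd : 2 * ℓ ≤ G.setDegree {b, d} + r b + r d
    · exact isRealizableMod_of_transfer hr hG h.swap (by omega) hba hb hc hbd
    have hd : 2 * ℓ ≤ G.vertexDegree d - r d := by
      have := hG.le_vertexDegree d h.swap_pairs.swap.mem
      omega
    obtain hac | hbc : 2 * ℓ ≤ G.setDegree {a, c} + r a + r c ∨
        2 * ℓ ≤ G.setDegree {b, c} + r b + r c := by
      omega
    · exact isRealizableMod_of_transfer hr hG h.swap_right (by omega) hab ha hd hac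
    · exact isRealizableMod_of_transfer hr hG h.swap.swap_right (by omega) hba hb hd hbc
  · have hd : 2 * ℓ ≤ G.vertexDegree d - r d := by
      have := hG.le_vertexDegree_add_add_setDegree_add h.swap
      rw [Set.pair_comm b a] at this
      omega
    have hac : 2 * ℓ ≤ G.setDegree {a, c} + r a + r c := by
      have := hG.le_vertexDegree b h.swap.mem
      omega
    exact isRealizableMod_of_transfer hr hG h.swap_right (by omega) hab ha hd hac

theorem isRealizableMod_of_isOverloaded_of_sum_eq_zero (h : IsVertexList G a b c d)
    (hsum : r a + r b + r c + r d = 0) (hab : IsOverloaded G r a b) (hlt : r a + r b < 2 * ℓ) :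
    IsRealizableMod G ℓ r := by
  have hba := isOverloaded_comm.1 hab
  have hle := (isOverloaded_iff h hr).1 hab
  obtain ⟨hpa, hpb, hpc, hpd⟩ := h.forall_mem_iff.1 fun v => hr.even_vertexDegree_add
  have hor : 2 * ℓ ≤ G.vertexDegree a + r a ∨ 2 * ℓ ≤ G.vertexDegree b + r b := by
    have := hG.le_vertexDegree_add_add_setDegree h
    omega
  have hor' : 2 * ℓ ≤ G.vertexDegree c - r c ∨ 2 * ℓ ≤ G.vertexDegree d - r d := by
    have := hG.le_vertexDegree_add_add_setDegree h.swap_pairs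
    rw [h.setDegree_pair_compl] at this
    omega
  obtain ha | hb := hor <;> obtain hc | hd := hor'
  · exact isRealizableMod_of_le_add_of_le_sub hr hG h hsum hab hlt ha hc
  · exact isRealizableMod_of_le_add_of_le_sub hr hG h.swap_right (by omega) hab hlt ha hd
  · exact isRealizableMod_of_le_add_of_le_sub hr hG h.swap (by omega) hba (by omega) hb hc
  · exact isRealizableMod_of_le_add_of_le_sub hr hG h.swap.swap_right (by omega) hba (by omega)
      hb hd

theorem isRealizableMod_of_sum_eq_zero (h : IsVertexList G a b c d)
    (hsum : r a + r b + r c + r d = 0) (hlt : ∀ v ∈ G.vertexSet, r v < ℓ) :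
    IsRealizableMod G ℓ r := by
  by_cases hover : ∃ x y z w, IsVertexList G x y z w ∧ IsOverloaded G r x y
  · obtain ⟨x, y, z, w, hxyzw, hxy⟩ := hover
    have hsum' : r x + r y + r z + r w = 0 := by
      classical
      rw [← hxyzw.sum_eq, ← hsum, ← h.sum_eq,
        Finset.coe_injective (hxyzw.vertexSet_eq_coe.symm.trans h.vertexSet_eq_coe)]
    refine isRealizableMod_of_isOverloaded_of_sum_eq_zero hr hG hxyzw hsum' hxy ?_
    linarith [hlt x hxyzw.mem, hlt y hxyzw.swap.mem]
  · have hle {x y z w : α} (h : IsVertexList G x y z w) (hsum : r x + r y + r z + r w = 0) :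
        |r x + r y| ≤ G.setDegree {x, y} := by
      push Not at hover
      have hxy := hover x y z w h
      have hzw := hover z w x y h.swap_pairs
      rw [IsOverloaded, not_lt] at hxy hzw
      rw [h.setDegree_pair_compl] at hzw
      rw [abs_le]
      constructor <;> linarith
    exact ⟨r, fun _ _ => rfl, h.isCutBounded hsum (fun v => hr.abs_le_vertexDegree hG) (hle h hsum)
      (hle h.swap_middle (by linarith)) (hle h.swap_right.swap_middle (by linarith))⟩

end Sufficiency

section Characterization

variable {ℓ : ℕ} {r : α → ℤ} {a b c d : α} [Finite G.edgeSet] [G.Loopless]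

theorem isRealizableMod_of_sum_eq_neg_four_mul (hr : IsReduced G ℓ r) (hG : IsDense G ℓ)
    (h : IsVertexList G a b c d) (hsum : r a + r b + r c + r d = -4 * ℓ)
    (hpair : (∀ v ∈ G.vertexSet, G.vertexDegree v ≡ ℓ [MOD 2]) →
      ∃ x ∈ G.vertexSet, ∃ y ∈ G.vertexSet, x ≠ y ∧ 2 * ℓ ≤ G.setDegree {x, y}) :
    IsRealizableMod G ℓ r := by
  have heq : ∀ v ∈ G.vertexSet, r v = -ℓ := by
    obtain ⟨ha, hb, hc, hd⟩ := h.forall_mem_iff.1 hr.abs_le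
    rw [abs_le] at ha hb hc hd
    exact h.forall_mem_iff.2 ⟨by omega, by omega, by omega, by omega⟩
  obtain ⟨x, hx, y, hy, hxy, hle⟩ := hpair fun v hv => by
    have := hr.even_vertexDegree_add hv
    rw [heq v hv] at this
    rw [Nat.ModEq]
    omega
  obtain ⟨z, w, h⟩ := h.exists_of_ne hx hy hxy
  obtain ⟨hdx, hdy, hdz, hdw⟩ := h.forall_mem_iff.1 fun v => hr.abs_le_vertexDegree hG
  obtain ⟨hrx, hry, hrz, hrw⟩ := h.forall_mem_iff.1 heq
  rw [abs_le] at hdx hdy hdz hdw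
  refine h.isRealizableMod 1 1 0 0 (by omega) ?_ ?_ ?_ ?_ ?_ ?_ ?_ <;> rw [abs_le] <;> omega

theorem isRealizableMod_of_isReduced (hr : IsReduced G ℓ r) (hG : IsDense G ℓ)
    (h : IsVertexList G a b c d) (hlt : ∀ v ∈ G.vertexSet, r v < ℓ)
    (hsum : 2 * (ℓ : ℤ) ∣ r a + r b + r c + r d)
    (hpair : (∀ v ∈ G.vertexSet, G.vertexDegree v ≡ ℓ [MOD 2]) →
      ∃ x ∈ G.vertexSet, ∃ y ∈ G.vertexSet, x ≠ y ∧ 2 * ℓ ≤ G.setDegree {x, y}) :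
    IsRealizableMod G ℓ r := by
  obtain ⟨ha, hb, hc, hd⟩ := h.forall_mem_iff.1 hr.abs_le
  obtain ⟨hlta, hltb, hltc, hltd⟩ := h.forall_mem_iff.1 hlt
  rw [abs_le] at ha hb hc hd
  obtain ⟨k, hk⟩ := hsum
  have hk_lt : k < 2 := by nlinarith
  have hk_ge : -2 ≤ k := by nlinarith
  interval_cases k
  · exact isRealizableMod_of_sum_eq_neg_four_mul hr hG h (by omega) hpair
  · refine .of_neg (isRealizableMod_of_sum_eq_two_mul hr.neg hG h ?_ fun v hv => ?_)
    · simp only [Pi.neg_apply]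
      omega
    · simpa using hlt v hv
  · exact isRealizableMod_of_sum_eq_zero hr hG h (by omega) hlt
  · refine isRealizableMod_of_sum_eq_two_mul hr hG h (by omega)
      (h.forall_mem_iff.2 ⟨?_, ?_, ?_, ?_⟩) <;> omega

theorem stronglyZConnected_of_isDense (hℓ : 0 < ℓ) (h : IsVertexList G a b c d)
    (hG : IsDense G ℓ)
    (hpair : (∀ v ∈ G.vertexSet, G.vertexDegree v ≡ ℓ [MOD 2]) →
      ∃ x ∈ G.vertexSet, ∃ y ∈ G.vertexSet, x ≠ y ∧ 2 * ℓ ≤ G.setDegree {x, y}) :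
    G.StronglyZConnected ℓ := by
  classical
  refine (stronglyZConnected_iff hℓ h.vertexSet_eq_coe).2 fun q hpar hsum => ?_
  choose r hrq hr_ge hr_lt using fun v => exists_modEq_mem_Ico hℓ (q v)
  have hr : IsReduced G ℓ r := by
    refine ⟨fun v hv => ?_, fun v _ => abs_le.2 ⟨hr_ge v, (hr_lt v).le⟩⟩
    exact ((hrq v).of_mul_right _).trans (hpar v (by simpa [h.vertexSet_eq] using hv))
  have hrsum : 2 * (ℓ : ℤ) ∣ r a + r b + r c + r d := by
    rw [← h.sum_eq, ← Int.modEq_zero_iff_dvd]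
    exact (Int.ModEq.sum fun v _ => hrq v).trans hsum
  exact (isRealizableMod_of_isReduced hr hG h (fun v _ => hr_lt v) hrsum hpair).of_modEq
    fun v _ => hrq v

theorem stronglyZConnected_iff_of_ncard_eq_four (hℓ : 0 < ℓ) (hV : G.vertexSet.ncard = 4)
    (hμ : ∀ x ∈ G.vertexSet, ∀ y ∈ G.vertexSet, x ≠ y → G.pairMultiplicity x y ≤ ℓ - 1) :
    G.StronglyZConnected ℓ ↔
      (∀ v ∈ G.vertexSet, ℓ - 1 ≤ G.vertexDegree v) ∧ 3 * ℓ - 3 ≤ G.numEdges ∧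
        ((∀ v ∈ G.vertexSet, G.vertexDegree v ≡ ℓ [MOD 2]) →
          ∃ x ∈ G.vertexSet, ∃ y ∈ G.vertexSet, x ≠ y ∧ 2 * ℓ ≤ G.setDegree {x, y}) := by
  classical
  obtain ⟨a, b, c, d, h⟩ := IsVertexList.exists_of_ncard_eq_four hV
  constructor
  · intro hconn
    have hcoe := h.vertexSet_eq_coe
    have hcard : ({a, b, c, d} : Finset α).card = 4 := by
      rw [← Set.ncard_coe_finset, ← hcoe, hV]
    have hedges := mul_le_numEdges_of_stronglyZConnected hℓ hcoe hconn
    have hpair := exists_two_mul_le_setDegree_of_stronglyZConnected hℓ hcoe (by omega)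
      (by rw [hcard]; decide) hconn
    rw [hcard] at hedges
    simp only [← Finset.mem_coe, ← hcoe] at hpair
    refine ⟨fun v hv => ?_, by omega, hpair⟩
    exact le_vertexDegree_of_stronglyZConnected hℓ hcoe (by omega) hconn (by simpa [hcoe] using hv)
  · rintro ⟨hdeg, hedges, hpair⟩
    exact stronglyZConnected_of_isDense hℓ h ⟨hμ, hdeg, hedges⟩ hpair

omit [Finite G.edgeSet] in
theorem exists_pairMultiplicity_eq_multiplicity (hpos : 0 < G.multiplicity) :
    ∃ x ∈ G.vertexSet, ∃ y ∈ G.vertexSet, x ≠ y ∧ G.pairMultiplicity x y = G.multiplicity := by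
  have hne : {m | ∃ x ∈ G.vertexSet, ∃ y ∈ G.vertexSet, G.pairMultiplicity x y = m}.Nonempty := by
    rw [Set.nonempty_iff_ne_empty]
    intro hempty
    rw [Graph.multiplicity, hempty, csSup_empty, bot_eq_zero] at hpos
    exact hpos.false
  have hbdd : BddAbove {m | ∃ x ∈ G.vertexSet, ∃ y ∈ G.vertexSet, G.pairMultiplicity x y = m} := by
    by_contra hunbdd
    rw [Graph.multiplicity, csSup_of_not_bddAbove hunbdd, csSup_empty, bot_eq_zero] at hpos
    exact hpos.false
  obtain ⟨x, hx, y, hy, hxy⟩ := Nat.sSup_mem hne hbdd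
  refine ⟨x, hx, y, hy, ?_, hxy⟩
  rintro rfl
  exact hpos.ne ((pairMultiplicity_self x).symm.trans hxy)

omit [Finite G.edgeSet] [G.Loopless] in
theorem le_minVertexDegree_iff (hne : G.vertexSet.Nonempty) {n : ℕ} :
    n ≤ G.minVertexDegree ↔ ∀ v ∈ G.vertexSet, n ≤ G.vertexDegree v := by
  rw [minVertexDegree, le_csInf_iff'' (hne.image _), Set.forall_mem_image]

theorem IsDense.setDegree_eq_of_modEq (hG : IsDense G ℓ)
    (hdeg : ∀ v ∈ G.vertexSet, G.vertexDegree v ≡ ℓ [MOD 2])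
    (hlt : ∀ x ∈ G.vertexSet, ∀ y ∈ G.vertexSet, x ≠ y → G.setDegree {x, y} < 2 * ℓ)
    (h : IsVertexList G a b c d) : G.setDegree {a, b} = 2 * ℓ - 2 := by
  have hle {x y z w : α} (h : IsVertexList G x y z w) : G.setDegree {x, y} ≤ 2 * ℓ - 2 := by
    have := h.vertexDegree_add_vertexDegree
    have hx := hdeg x h.mem
    have hy := hdeg y h.swap.mem
    have := hlt x h.mem y h.swap.mem h.ne
    rw [Nat.ModEq] at hx hy
    omega
  have := hle h
  have := hle h.swap_middle
  have := hle h.swap_right.swap_middle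
  have := hG.le_sum_setDegree_pair h
  omega

theorem IsDense.exists_setDegree_ne_of_multiplicity_eq (hG : IsDense G ℓ) (hℓ : 2 ≤ ℓ)
    (h : IsVertexList G a b c d) (hdeg : ∀ v ∈ G.vertexSet, G.vertexDegree v ≡ ℓ [MOD 2])
    (hμ : G.multiplicity = ℓ - 1) :
    ∃ x y z w, IsVertexList G x y z w ∧ G.setDegree {x, y} ≠ 2 * ℓ - 2 := by
  by_contra! hcut
  obtain ⟨x, hx, y, hy, hxy, hm⟩ := exists_pairMultiplicity_eq_multiplicity (G := G) (by omega)
  obtain ⟨z, w, h⟩ := h.exists_of_ne hx hy hxy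
  have hxy_cut := hcut _ _ _ _ h
  have hzw : 1 ≤ G.pairMultiplicity z w := by
    have := h.swap_pairs.vertexDegree_add_vertexDegree
    have := h.setDegree_pair_compl
    have := hG.le_vertexDegree z h.swap_pairs.mem
    have := hG.le_vertexDegree w h.swap_pairs.swap.mem
    have hz := hdeg z h.swap_pairs.mem
    have hw := hdeg w h.swap_pairs.swap.mem
    rw [Nat.ModEq] at hz hw
    omega
  have := h.numEdges_eq
  have := h.sum_setDegree_pair
  have := hcut _ _ _ _ h.swap_middle
  have := hcut _ _ _ _ h.swap_right.swap_middle
  omega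

theorem IsDense.conditions_iff_exists_two_mul_le_setDegree (hG : IsDense G ℓ)
    (hV : G.vertexSet.ncard = 4) (hℓ : 2 ≤ ℓ) :
    ((G.multiplicity = ℓ - 1 ∨ 3 * ℓ - 2 ≤ G.numEdges) ∨
      (∃ S : Set α, S ⊆ G.vertexSet ∧ S.ncard = 2 ∧ G.setDegree S ≠ 2 * ℓ - 2) ∨
      (∃ v ∈ G.vertexSet, ¬ G.vertexDegree v ≡ ℓ [MOD 2])) ↔
    ((∀ v ∈ G.vertexSet, G.vertexDegree v ≡ ℓ [MOD 2]) →
      ∃ x ∈ G.vertexSet, ∃ y ∈ G.vertexSet, x ≠ y ∧ 2 * ℓ ≤ G.setDegree {x, y}) := by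
  obtain ⟨a, b, c, d, h⟩ := IsVertexList.exists_of_ncard_eq_four hV
  constructor
  · intro hcond hdeg
    by_contra! hlt
    have hcut := fun {x y z w} (h : IsVertexList G x y z w) => hG.setDegree_eq_of_modEq hdeg hlt h
    rcases hcond with (hμ | hedges) | ⟨S, hS, hcard, hne⟩ | ⟨v, hv, hv'⟩
    · obtain ⟨x, y, z, w, h, hne⟩ := hG.exists_setDegree_ne_of_multiplicity_eq hℓ h hdeg hμ
      exact hne (hcut h)
    · have := h.sum_setDegree_pair
      rw [hcut h, hcut h.swap_middle, hcut h.swap_right.swap_middle] at this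
      omega
    · obtain ⟨x, y, hxy, rfl⟩ := Set.ncard_eq_two.1 hcard
      obtain ⟨z, w, h⟩ := h.exists_of_ne (hS (by simp)) (hS (by simp)) hxy
      exact hne (hcut h)
    · exact hv' (hdeg v hv)
  · intro hpair
    by_cases hdeg : ∀ v ∈ G.vertexSet, G.vertexDegree v ≡ ℓ [MOD 2]
    · obtain ⟨x, hx, y, hy, hxy, hle⟩ := hpair hdeg
      exact .inr (.inl ⟨{x, y}, by grind, Set.ncard_pair hxy, by omega⟩)
    · push Not at hdeg
      exact .inr (.inr hdeg)

end Characterization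

end StrongZConnectivity

theorem mainTheorem2 {α β γ : Type*} (ℓ : ℕ) (hℓ : 2 ≤ ℓ)
    (G₀ : Graph α β) (hG₀ : G₀.Loopless) (hE : G₀.edgeSet.Finite) (hV : G₀.vertexSet.ncard = 4)
    (G : Graph α γ) (hG : Graph.IsSimplifiedGraph ℓ G₀ G) :
    G₀.StronglyZConnected ℓ ↔
      ℓ - 1 ≤ G.minVertexDegree ∧
      3 * ℓ - 3 ≤ G.numEdges ∧
      ((G.multiplicity = ℓ - 1 ∨ 3 * ℓ - 2 ≤ G.numEdges) ∨
        (∃ S : Set α, S ⊆ G.vertexSet ∧ S.ncard = 2 ∧ G.setDegree S ≠ 2 * ℓ - 2) ∨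
        (∃ v ∈ G.vertexSet, ¬ G.vertexDegree v ≡ ℓ [MOD 2])) := by
  have := hE.to_subtype
  have := hG.edgeSet_finite.to_subtype
  have := hG.loopless
  have hV' : G.vertexSet.ncard = 4 := hG.vertexSet_eq ▸ hV
  have hne : G.vertexSet.Nonempty := Set.nonempty_of_ncard_ne_zero (by omega)
  have hfin : G₀.vertexSet.Finite := Set.finite_of_ncard_ne_zero (by omega)
  obtain ⟨V, hcoe⟩ := hfin.exists_finset_coe
  have hμ : ∀ x ∈ G.vertexSet, ∀ y ∈ G.vertexSet, x ≠ y → G.pairMultiplicity x y ≤ ℓ - 1 := by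
    rw [hG.vertexSet_eq]
    intro x hx y hy hxy
    exact (hG.pairMultiplicity_eq x hx y hy hxy).trans_le (min_le_right _ _)
  rw [StrongZConnectivity.stronglyZConnected_iff_of_isSimplifiedGraph (by omega) hcoe.symm hG,
    StrongZConnectivity.stronglyZConnected_iff_of_ncard_eq_four (by omega) hV' hμ,
    StrongZConnectivity.le_minVertexDegree_iff hne]
  refine and_congr_right fun hdeg => and_congr_right fun hedges => ?_
  have hdense : StrongZConnectivity.IsDense G ℓ := ⟨hμ, hdeg, hedges⟩
  exact (hdense.conditions_iff_exists_two_mul_le_setDegree hV' hℓ).symm
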